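/- Conventions. For a group $\Gamma$ let $r(\Gamma)$ be its minimal number of generators. A splitting of $\Gamma$ is an action of $\Gamma$ without inversions on a simplicial tree $X$ (equivalently, by Bass–Serre theory, a decomposition of $\Gamma$ as the fundamental group of a graph of groups with underlying graph $X/\Gamma$). Vertex and edge groups are the stabilizers $\Gamma_x$, $\Gamma_e$ of vertices and edges of $X$. An element is elliptic if it fixes a vertex and hyperbolic otherwise. The splitting is * *elliptic* if every element of $\Gamma$ is elliptic; * *reduced* if, for each edge $e$ of $X$ whose image in $X/\Gamma$ is not a loop, $\Gamma_e$ is a proper subgroup of the stabilizers of both endpoints of $e$; * *$k$-acylindrical* if the pointwise stabilizer of every path of length greater than $k+1$ in $X$ is trivial; * *over free abelian groups of rank at most $n$* if every edge group is isomorphic to $\mathbb Z^m$ for some $0\le m\le n$. A vertex $x$ is *degenerate* if $\Gamma_x=\Gamma_e$ for some edge $e$ incident to $x$. Let $\mathcal C$ be a class of groups closed under isomorphism and under passing to subgroups of finite index, and let $\varphi_0:\mathcal C\to[0,\infty)$ be an isomorphism-invariant function such that $\varphi_0(\Delta)=[\Gamma:\Delta]\,\varphi_0(\Gamma)$ whenever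 $\Gamma\in\mathcal C$ and $\Delta\le\Gamma$ has finite index, and such that, for some constants $A_3,A_4\in\mathbb R$, $\varphi_0(\Gamma)\le A_3\,r(\Gamma)+A_4$ for all finitely generated $\Gamma\in\mathcal C$. Put $\varphi(\Gamma)=\varphi_0(\Gamma)$ if $\Gamma\in\mathcal C$ and $\varphi(\Gamma)=0$ otherwise. The *weighted complexity* of a splitting of $\Gamma$ with tree $X$ is $1$ if the splitting is elliptic, and otherwise $$C^{\varphi}(X)=r(\pi_1(X/\Gamma))+\sum_{v}\bigl(1+\varphi(\Gamma_v)\bigr)\in[0,\infty],$$ where the sum is over the non-degenerate vertices $v$ of $X/\Gamma$. For $k\ge 0$ and $n\ge1$, let $C^{\varphi}_{\max}(\Gamma)$ be the supremum of $C^{\varphi}(X)$ over all reduced $k$-acylindrical splittings of $\Gamma$ over free abelian groups of rank at most $n$, and define the volume $$V^{\varphi}_{n}(\Gamma)=\limsup_{H}\frac{C^{\varphi}_{\max}(H)}{[\Gamma:H]}\in[0,\infty],$$ the upper limit along the normal subgroups $H$ of finite index of $\Gamma$, directed by reverse inclusion (it depends on $k$ as well). Theorem. Let $G$ be a finitely generated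 one-ended group, let $k\ge0$ and $n\ge1$, and suppose that $G$ has a $k$-acylindrical splitting over free abelian groups of rank at most $n$ (not necessarily reduced or minimal) in which some element of $G$ is hyperbolic. If there is a vertex group $G_v\neq1$ of this splitting with $\varphi(G_v)>0$, then $$V^{\varphi}_{n}(G)>0,\qquad\text{and in fact}\qquad V^{\varphi}_{n}(G)\ \ge\ \varphi(G_v).$$ -/

import Mathlib

open scoped NNReal ENNReal

universe u

noncomputable section

open Filter CategoryTheory

/-- The minimal number of generators of a group (`⊤` if the group is not finitely generated). -/
def genRank (Γ : Type u) [Group Γ] : ℕ∞ :=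
  ⨅ (S : Set Γ) (_ : Subgroup.closure S = ⊤), S.encard

/-- A group is one-ended if it has a finite generating set whose Cayley graph has exactly one
end. -/
def IsOneEnded (Γ : Type u) [Group Γ] : Prop :=
  ∃ S : Finset Γ, Subgroup.closure (S : Set Γ) = ⊤ ∧
    ∃! ε, ε ∈ (SimpleGraph.mulCayley (S : Set Γ)).end

/-- `Γ` is free abelian of rank at most `n`. -/
def IsFreeAbelianOfRankLE (n : ℕ) (Γ : Type u) [Group Γ] : Prop :=
  ∃ m : ℕ, m ≤ n ∧ Nonempty (Γ ≃* Multiplicative (Fin m → ℤ))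

/-- A nonnegative volume (generalised Euler characteristic) on a class of groups: the class is
closed under isomorphism and under passing to subgroups of finite index, and on it the volume is
invariant under isomorphism, multiplicative in the index, and bounded by a linear function of the
minimal number of generators. The value of `vol` outside the class is irrelevant. -/
structure GroupVolume where
  /-- the class of groups -/
  mem : ∀ (Γ : Type u) [Group Γ], Prop
  /-- the volume -/
  vol : ∀ (Γ : Type u) [Group Γ], ℝ≥0
  mem_of_mulEquiv : ∀ (Γ Δ : Type u) [Group Γ] [Group Δ], Nonempty (Γ ≃* Δ) → mem Γ → mem Δ
  vol_eq_of_mulEquiv : ∀ (Γ Δ : Type u) [Group Γ] [Group Δ], Nonempty (Γ ≃* Δ) → mem Γ →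
    vol Γ = vol Δ
  mem_subgroup : ∀ (Γ : Type u) [Group Γ] (H : Subgroup Γ), H.FiniteIndex → mem Γ → mem H
  vol_subgroup : ∀ (Γ : Type u) [Group Γ] (H : Subgroup Γ), H.FiniteIndex → mem Γ →
    vol H = (H.index : ℝ≥0) * vol Γ
  linear_bound : ∃ A B : ℝ, ∀ (Γ : Type u) [Group Γ], mem Γ → ∀ m : ℕ, genRank Γ = m →
    (vol Γ : ℝ) ≤ A * m + B

open Classical in
/-- The extension by zero of a volume to all groups. -/
def GroupVolume.weight (φ : GroupVolume.{u}) (Γ : Type u) [Group Γ] : ℝ≥0 :=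
  if φ.mem Γ then φ.vol Γ else 0

/-- A `Γ`-tree: a (simplicial) tree with an action of `Γ` by automorphisms, without inversions.
By Bass-Serre theory this is the same as a splitting of `Γ` as the fundamental group of a graph
of groups; the underlying graph is the quotient of the tree by `Γ`. -/
structure GTree (Γ : Type u) [Group Γ] where
  /-- the vertices -/
  V : Type u
  /-- the tree -/
  graph : SimpleGraph V
  isTree : graph.IsTree
  /-- the action on the vertices -/
  [action : MulAction Γ V]
  adj_smul : ∀ (g : Γ) (x y : V), graph.Adj x y → graph.Adj (g • x) (g • y)
  not_inverted : ∀ (g : Γ) (x y : V), graph.Adj x y → ¬ (g • x = y ∧ g • y = x)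

attribute [instance] GTree.action

namespace GTree

variable {Γ : Type u} [Group Γ] (T : GTree Γ)

/-- The stabilizer of a vertex. -/
abbrev stab (x : T.V) : Subgroup Γ := MulAction.stabilizer Γ x

/-- The stabilizer of the edge with endpoints `x` and `y`; more generally the (pointwise)
stabilizer of the path from `x` to `y`. -/
abbrev pathStab (x y : T.V) : Subgroup Γ := T.stab x ⊓ T.stab y

/-- The action is elliptic if every element of the group fixes a vertex; otherwise the group
contains hyperbolic elements, as there are no inversions. -/
def IsElliptic : Prop := ∀ g : Γ, ∃ x : T.V, g • x = x

/-- A vertex is degenerate if its stabilizer equals the stabilizer of an incident edge. -/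
def IsDegenerate (x : T.V) : Prop := ∃ y, T.graph.Adj x y ∧ T.pathStab x y = T.stab x

/-- The splitting is reduced if the stabilizer of each edge that does not become a loop in the
quotient graph is a proper subgroup of the stabilizers of both of its endpoints. -/
def IsReduced : Prop := ∀ x y : T.V, T.graph.Adj x y → y ∉ MulAction.orbit Γ x →
  T.pathStab x y < T.stab x ∧ T.pathStab x y < T.stab y

/-- The action is `k`-acylindrical if the stabilizer of every path of length greater than `k + 1`
is trivial. -/
def IsAcylindrical (k : ℕ) : Prop :=
  ∀ (x y : T.V) (p : T.graph.Walk x y), p.IsPath → k + 1 < p.length → T.pathStab x y = ⊥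

/-- All edge stabilizers are free abelian of rank at most `n`. -/
def HasFreeAbelianEdges (n : ℕ) : Prop :=
  ∀ x y : T.V, T.graph.Adj x y → IsFreeAbelianOfRankLE n (T.pathStab x y)

/-- The vertices of the quotient graph: the orbits of vertices. -/
def QuotVert : Type u := MulAction.orbitRel.Quotient Γ T.V

/-- The image of a vertex in the quotient graph. -/
def toQuot (x : T.V) : T.QuotVert := _root_.Quotient.mk (MulAction.orbitRel Γ T.V) x

/-- The orbit of a pair of vertices. -/
def pairOrbit (x y : T.V) : MulAction.orbitRel.Quotient Γ (T.V × T.V) :=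
  _root_.Quotient.mk (MulAction.orbitRel Γ (T.V × T.V)) (x, y)

/-- The quotient graph: its oriented edges are the orbits of the oriented edges of the tree, so
each geometric edge of the quotient graph gives two oriented ones. -/
instance quotQuiver : Quiver T.QuotVert where
  Hom a b := {o : MulAction.orbitRel.Quotient Γ (T.V × T.V) //
    ∃ x y, T.graph.Adj x y ∧ T.pairOrbit x y = o ∧ T.toQuot x = a ∧ T.toQuot y = b}

/-- Two oriented edges of the quotient graph are reverse to each other. -/
def IsReverse {a b : T.QuotVert} (e : a ⟶ b) (f : b ⟶ a) : Prop :=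
  ∃ x y, T.graph.Adj x y ∧ T.pairOrbit x y = e.1 ∧ T.pairOrbit y x = f.1

/-- The elementary homotopies of edge paths in the quotient graph: an edge followed by its reverse
is homotopic to the constant path. -/
inductive Backtrack : HomRel (Paths T.QuotVert)
  | mk {a b : T.QuotVert} (e : a ⟶ b) (f : b ⟶ a) (h : T.IsReverse e f) :
      Backtrack ((Paths.of T.QuotVert).map e ≫ (Paths.of T.QuotVert).map f)
        (𝟙 ((Paths.of T.QuotVert).obj a))

/-- The fundamental groupoid of the quotient graph: edge paths up to homotopy. -/
def QuotGroupoid : Type u := CategoryTheory.Quotient T.Backtrack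

instance quotGroupoidCategory : Category.{u} T.QuotGroupoid := Quotient.category T.Backtrack

/-- The fundamental group of the quotient graph, based at the image of the vertex `x`. -/
abbrev QuotPi1 (x : T.V) : Type u :=
  Aut (CategoryTheory.Quotient.mk (T.toQuot x) : T.QuotGroupoid)

/-- The rank of the free group which is the fundamental group of the quotient graph. -/
def quotRank : ℕ∞ := genRank (T.QuotPi1 T.isTree.connected.nonempty.some)

open Classical in
/-- The weighted complexity of a splitting: `1` for an elliptic action, otherwise the rank of the
fundamental group of the quotient graph plus the sum of `1 + φ` over the vertex groups of the
non-degenerate vertices of the quotient graph. -/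
def complexity (φ : GroupVolume.{u}) : ℝ≥0∞ :=
  if T.IsElliptic then 1
  else (T.quotRank : ℝ≥0∞) + ∑' o : MulAction.orbitRel.Quotient Γ T.V,
    if T.IsDegenerate o.out then 0 else 1 + (φ.weight (T.stab o.out) : ℝ≥0∞)

end GTree

/-- The maximal weighted complexity over all reduced `k`-acylindrical splittings over free abelian
groups of rank at most `n`. -/
def maxComplexity (φ : GroupVolume.{u}) (k n : ℕ) (Γ : Type u) [Group Γ] : ℝ≥0∞ :=
  ⨆ (T : GTree Γ) (_ : T.IsReduced ∧ T.IsAcylindrical k ∧ T.HasFreeAbelianEdges n),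
    T.complexity φ

/-- The volume of `Γ`: the upper limit of the maximal weighted complexity of `H` divided by the
index of `H`, along the normal subgroups `H` of finite index, directed by reverse inclusion. -/
def acylVolume (φ : GroupVolume.{u}) (k n : ℕ) (Γ : Type u) [Group Γ] : ℝ≥0∞ :=
  limsup (fun H : FiniteIndexNormalSubgroup Γ =>
    maxComplexity φ k n H.toSubgroup / (H.toSubgroup.index : ℝ≥0∞)) atBot

end

/-!
The volume of `G` is bounded below by bounding, for each normal subgroup `H` of finite index, the
complexity of one well-chosen splitting of `H`: the restriction to `H` of the given action on the
tree, made cocompact and reduced (`GTree.index_mul_weight_le_maxComplexity`).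

The `G`-orbit of `v` falls into `[G : H Gᵥ]` orbits of `H`, and the stabilizers in `H` of its
vertices are all isomorphic to `H ∩ Gᵥ`, whose weight is `[Gᵥ : H ∩ Gᵥ] φ(Gᵥ)`. So these orbits
contribute `[G : H] φ(Gᵥ)` to the complexity, provided that they survive in a reduced splitting as
nondegenerate vertices. They do, because their stabilizers have positive weight and are infinite,
whereas an infinite free abelian group has weight zero, being isomorphic to a proper subgroup of
finite index (`GroupVolume.weight_eq_zero`). Hence they are not edge groups.

That `Gᵥ` is infinite is where one-endedness enters (`GTree.infinite_stab`). If `Gᵥ` is finite, the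
incident edges have trivial stabilizers. Let `A` be the set of elements that move `v` to the far
side of an incident edge pointing to another vertex of the orbit of `v`. It has finite coboundary
in the Cayley graph, as `Gᵥ` is finite. It is infinite, as for
every point `u = g v` beyond the edge, the conjugate by `g` of a nontrivial element of `Gᵥ` moves
`v` to a point beyond the edge which is twice as far from `v` as `u`. Its complement is infinite
too, as it contains a translate of `A`. This gives two ends of the Cayley graph, through
ultrafilters containing `A` and its complement.

To reduce a splitting of a finitely generated group, first pass to an invariant subtree with finite
quotient (`GTree.exists_subtree`), then collapse, one orbit at a time, the edges violating the
condition (`GTree.exists_reduction_of_stab_le`). If the stabilizer of `x` is contained in that of an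
adjacent, inequivalent vertex `y`, collapsing the orbit of the edge amounts to an equivariant
retraction of the tree to the vertices outside the orbit of `x`. It increases neither distances nor
edge groups, so it preserves acylindricity, and the remaining vertices keep their stabilizers. The
number of orbits drops, so the process ends (`GTree.exists_isReduced`).

The restricted action still has hyperbolic elements, because an element of which some positive power
fixes a vertex fixes a vertex itself: it preserves the center of a finite orbit
(`GTree.exists_smul_eq_of_pow_smul_eq`).
-/

noncomputable section

open Filter CategoryTheory

/-! ### Distances in trees -/

namespace SimpleGraph

variable {V : Type u} {X : SimpleGraph V}

lemma Walk.dist_add_dist_of_mem_support {p q m : V} (w : X.Walk p q) (hw : w.length = X.dist p q)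
    (hm : m ∈ w.support) : X.dist p m + X.dist m q = X.dist p q := by
  classical
  have h1 := dist_le (w.takeUntil m hm)
  have h2 := dist_le (w.dropUntil m hm)
  have h3 := congrArg Walk.length (w.take_spec hm)
  rw [Walk.length_append] at h3
  have h4 := Reachable.dist_triangle_left (w.takeUntil m hm).reachable q
  omega

/-- In a tree, a vertex on the geodesic from `p` to `q` is visited by every walk from `p` to
`q`. -/
lemma IsTree.mem_support_of_dist_add_dist (hX : X.IsTree) {p q m : V}
    (h : X.dist p m + X.dist m q = X.dist p q) (w : X.Walk p q) : m ∈ w.support := by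
  classical
  obtain ⟨w₁, -, h₁⟩ := hX.connected.exists_path_of_dist p m
  obtain ⟨w₂, -, h₂⟩ := hX.connected.exists_path_of_dist m q
  have hp : (w₁.append w₂).IsPath := by
    apply Walk.isPath_of_length_eq_dist
    rw [Walk.length_append]; omega
  have := (hX.existsUnique_path p q).unique hp (w.bypass_isPath)
  apply w.support_bypass_subset_support
  rw [← this, Walk.mem_support_append_iff]
  exact Or.inl w₁.end_mem_support

lemma IsTree.length_eq_dist (hX : X.IsTree) {p q : V} {w : X.Walk p q} (hw : w.IsPath) :
    w.length = X.dist p q := by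
  obtain ⟨w', h', hl⟩ := hX.connected.exists_path_of_dist p q
  rw [(hX.existsUnique_path p q).unique hw h', hl]

/-- A geodesic triangle in a tree is degenerate: each side is covered by the two others. -/
lemma IsTree.between_or_between (hX : X.IsTree) {p q m : V}
    (h : X.dist p m + X.dist m q = X.dist p q) (o : V) :
    X.dist p m + X.dist m o = X.dist p o ∨ X.dist o m + X.dist m q = X.dist o q := by
  obtain ⟨w₁, -, h₁⟩ := hX.connected.exists_path_of_dist p o
  obtain ⟨w₂, -, h₂⟩ := hX.connected.exists_path_of_dist o q
  have := hX.mem_support_of_dist_add_dist h (w₁.append w₂)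
  rw [Walk.mem_support_append_iff] at this
  exact this.imp (w₁.dist_add_dist_of_mem_support h₁) (w₂.dist_add_dist_of_mem_support h₂)

lemma IsTree.eq_of_between (hX : X.IsTree) {p q m m' : V}
    (h : X.dist p m + X.dist m q = X.dist p q) (h' : X.dist p m' + X.dist m' q = X.dist p q)
    (hm : X.dist p m = X.dist p m') : m = m' := by
  rw [← hX.connected.dist_eq_zero_iff]
  have := X.dist_comm (u := m) (v := m')
  rcases hX.between_or_between h m' with h1 | h1 <;> omega

lemma Connected.exists_between (hX : X.Connected) (p q : V) {i : ℕ} (hi : i ≤ X.dist p q) :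
    ∃ m, X.dist p m = i ∧ i + X.dist m q = X.dist p q := by
  obtain ⟨w, hw⟩ := hX.exists_walk_length_eq_dist p q
  have h1 := dist_le (w.take i)
  have h2 := dist_le (w.drop i)
  have h3 := hX.dist_triangle (u := p) (v := w.getVert i) (w := q)
  rw [Walk.take_length] at h1
  rw [Walk.drop_length] at h2
  exact ⟨w.getVert i, by omega, by omega⟩

/-- A map of vertices which sends adjacent vertices to equal or adjacent ones maps walks to walks
which are at most as long. -/
lemma exists_walk_length_le_of_map {V' : Type u} {X' : SimpleGraph V'} (ρ : V → V')
    (hρ : ∀ a b, X.Adj a b → ρ a = ρ b ∨ X'.Adj (ρ a) (ρ b)) {a b : V} (w : X.Walk a b) :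
    ∃ w' : X'.Walk (ρ a) (ρ b), w'.length ≤ w.length := by
  induction w with
  | nil => exact ⟨.nil, le_rfl⟩
  | cons h p ih =>
    obtain ⟨w', hw'⟩ := ih
    rcases hρ _ _ h with e | e
    · exact ⟨w'.copy e.symm rfl, by simp; omega⟩
    · exact ⟨.cons e w', by simpa using hw'⟩

/-- A finite nonempty set of vertices of a tree has a center: if two vertices minimize the largest
distance to the set, then they are equal or adjacent. -/
lemma IsTree.exists_center (hX : X.IsTree) {O : Finset V} (hO : O.Nonempty) :
    ∃ r : ℕ, (∃ p, ∀ o ∈ O, X.dist p o ≤ r) ∧ ∀ p q, (∀ o ∈ O, X.dist p o ≤ r) →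
      (∀ o ∈ O, X.dist q o ≤ r) → X.dist p q ≤ 1 := by
  classical
  have hex : ∃ r : ℕ, ∃ p, ∀ o ∈ O, X.dist p o ≤ r := by
    obtain ⟨p⟩ := hX.connected.nonempty
    exact ⟨O.sup (X.dist p), p, fun o ho => Finset.le_sup (f := X.dist p) ho⟩
  refine ⟨Nat.find hex, Nat.find_spec hex, fun p q hp hq => ?_⟩
  by_contra! hpq
  -- an inner vertex of the geodesic from `p` to `q` is strictly closer to the whole set
  obtain ⟨m, hm1, hm2⟩ := hX.connected.exists_between p q (i := 1) (by omega)
  have key : ∀ o ∈ O, X.dist m o + 1 ≤ Nat.find hex := by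
    intro o ho
    have h1 := hp o ho
    have h2 := hq o ho
    have := X.dist_comm (u := m) (v := o)
    have := X.dist_comm (u := q) (v := o)
    rcases hX.between_or_between (m := m) (p := p) (q := q) (by omega) o with h | h <;> omega
  obtain ⟨o₀, ho₀⟩ := hO
  have h0 := key o₀ ho₀
  refine Nat.find_min hex (m := Nat.find hex - 1) (by omega) ⟨m, fun o ho => ?_⟩
  have := key o ho
  omega

end SimpleGraph

/-! ### Ends of graphs and groups -/

namespace SimpleGraph

variable {V : Type u} {X : SimpleGraph V}

/-- An infinite set `B` of vertices of a connected locally finite graph accumulates at some end.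
The end picks the component which belongs to a fixed nonprincipal ultrafilter containing `B`. -/
lemma exists_mem_end_inter_nonempty [LocallyFinite X] (hX : X.Preconnected) {B : Set V}
    (hB : B.Infinite) :
    ∃ ε ∈ X.end, ∀ K : Finset V, ((ε (Opposite.op K) : X.ComponentCompl K).supp ∩ B).Nonempty := by
  have : Fact X.Preconnected := ⟨hX⟩
  have hne : NeBot (cofinite ⊓ 𝓟 B) := cofinite_inf_principal_neBot_iff.2 hB
  let F : Ultrafilter V := Ultrafilter.of (cofinite ⊓ 𝓟 B)
  have hF : (F : Filter V) ≤ cofinite ⊓ 𝓟 B := Ultrafilter.of_le _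
  have hBF : B ∈ F := hF (mem_inf_of_right (mem_principal_self B))
  have hex : ∀ K : Finset V, ∃ C : X.ComponentCompl K, C.supp ∈ F := by
    intro K
    have hK : ((K : Set V)ᶜ) ∈ F := hF (mem_inf_of_left K.finite_toSet.compl_mem_cofinite)
    have := (Ultrafilter.finite_sUnion_mem_iff (f := F)
      (Set.finite_range (fun C : X.ComponentCompl K => C.supp))).1 (mem_of_superset hK ?_)
    · obtain ⟨_, ⟨C, rfl⟩, hC⟩ := this
      exact ⟨C, hC⟩
    · intro x hx
      exact ⟨_, ⟨X.componentComplMk hx, rfl⟩, hx, rfl⟩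
  choose C hC using hex
  refine ⟨fun K => C K.unop, ?_, fun K => F.nonempty_of_mem (inter_mem (hC K) hBF)⟩
  intro K L f
  have h := inter_mem (hC K.unop) (hC L.unop)
  exact ((C K.unop).hom_eq_iff_not_disjoint (le_of_op_hom f) (C L.unop)).2
    (Set.not_disjoint_iff_nonempty_inter.2 (F.nonempty_of_mem h))

/-- A connected locally finite graph with exactly one end has no infinite set of vertices with
infinite complement such that all edges leaving the set have an endpoint in a fixed finite set. -/
lemma not_infinite_compl_of_existsUnique_end [LocallyFinite X] (hX : X.Preconnected)
    (h1 : ∃! ε, ε ∈ X.end) {A : Set V} (hA : A.Infinite) {K : Set V} (hK : K.Finite)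
    (hAK : ∀ a b, X.Adj a b → a ∈ A → b ∉ A → a ∈ K ∨ b ∈ K) : ¬ Aᶜ.Infinite := by
  intro hA'
  obtain ⟨ε, hε, hε'⟩ := exists_mem_end_inter_nonempty hX hA
  obtain ⟨δ, hδ, hδ'⟩ := exists_mem_end_inter_nonempty hX hA'
  obtain rfl := h1.unique hε hδ
  let L : Finset V := hK.toFinset
  obtain ⟨a, ⟨haL, ha⟩, haA⟩ := hε' L
  obtain ⟨b, ⟨hbL, hb⟩, hbA⟩ := hδ' L
  have hab := ha.trans hb.symm
  rw [ConnectedComponent.eq] at hab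
  obtain ⟨w⟩ := hab
  obtain ⟨d, -, hd, hd'⟩ := w.exists_boundary_dart (Subtype.val ⁻¹' A) haA hbA
  have hadj : X.Adj d.fst.1 d.snd.1 := d.adj
  rcases hAK _ _ hadj hd hd' with h | h
  · exact d.fst.2 (by simpa [L] using h)
  · exact d.snd.2 (by simpa [L] using h)

/-- The Cayley graph of a finite subset is locally finite. -/
lemma nonempty_locallyFinite_mulCayley {G : Type u} [Group G] (S : Finset G) :
    Nonempty (LocallyFinite (mulCayley (S : Set G))) := by
  classical
  refine ⟨fun g => Set.Finite.fintype (Set.Finite.subset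
    ((S.finite_toSet.image (g * ·)).union (S.finite_toSet.image (g * ·⁻¹))) ?_)⟩
  intro h hh
  rw [mem_neighborSet, mulCayley_adj'] at hh
  obtain ⟨-, s, hs, rfl | rfl⟩ := hh
  · exact Or.inl ⟨s, hs, rfl⟩
  · exact Or.inr ⟨s, hs, by simp⟩

lemma preconnected_mulCayley {G : Type u} [Group G] {S : Set G} (hS : Subgroup.closure S = ⊤) :
    (mulCayley S).Preconnected := by
  have h1 : ∀ g h : G, h ∈ S → (mulCayley S).Reachable g (g * h) := by
    intro g h hh
    by_cases e : g = g * h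
    · rw [← e]
    · exact Adj.reachable ((mulCayley_adj' _ _ _).2 ⟨e, h, hh, Or.inl rfl⟩)
  have h2 : ∀ g h : G, (mulCayley S).Reachable g (g * h) := by
    intro g h
    have hh : h ∈ Subgroup.closure S := hS ▸ Subgroup.mem_top h
    induction hh using Subgroup.closure_induction generalizing g with
    | mem x hx => exact h1 g x hx
    | one => simp
    | mul x y _ _ ihx ihy => rw [← mul_assoc]; exact (ihx g).trans (ihy _)
    | inv x _ ih => simpa using (ih (g * x⁻¹)).symm
  intro g h
  simpa using h2 g (g⁻¹ * h)

end SimpleGraph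

/-- A subset of a one-ended group which differs only finitely from its right translates by
generators (that is, has finite coboundary) is finite or has finite complement. -/
lemma IsOneEnded.not_infinite_compl {G : Type u} [Group G] (hG : IsOneEnded G) {A : Set G}
    (hA : A.Infinite) (hAK : ∀ s : G, {g : G | g ∈ A ∧ g * s ∉ A}.Finite) : ¬ Aᶜ.Infinite := by
  obtain ⟨S, hS, h1⟩ := hG
  obtain ⟨_⟩ := SimpleGraph.nonempty_locallyFinite_mulCayley S
  refine SimpleGraph.not_infinite_compl_of_existsUnique_end
    (SimpleGraph.preconnected_mulCayley hS) h1 hA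
    (K := ⋃ s ∈ (S : Set G), ({g : G | g ∈ A ∧ g * s ∉ A} ∪ {g : G | g ∈ A ∧ g * s⁻¹ ∉ A}))
    (S.finite_toSet.biUnion fun s _ => (hAK s).union (hAK s⁻¹)) fun a b hab ha hb => Or.inl ?_
  rw [SimpleGraph.mulCayley_adj'] at hab
  obtain ⟨-, s, hs, rfl | rfl⟩ := hab
  · exact Set.mem_biUnion hs (Or.inl ⟨ha, hb⟩)
  · exact Set.mem_biUnion hs (Or.inr ⟨ha, by simpa using hb⟩)

/-! ### Group actions on trees -/

namespace GTree

variable {Γ : Type u} [Group Γ] (T : GTree Γ)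

lemma adj_smul_iff (g : Γ) (x y : T.V) : T.graph.Adj (g • x) (g • y) ↔ T.graph.Adj x y :=
  ⟨fun h => by simpa using T.adj_smul g⁻¹ _ _ h, T.adj_smul g x y⟩

lemma dist_smul (g : Γ) (x y : T.V) : T.graph.dist (g • x) (g • y) = T.graph.dist x y := by
  have key : ∀ (g : Γ) (x y : T.V), T.graph.dist (g • x) (g • y) ≤ T.graph.dist x y := by
    intro g x y
    obtain ⟨w, hw⟩ := T.isTree.connected.exists_walk_length_eq_dist x y
    obtain ⟨w', hw'⟩ := SimpleGraph.exists_walk_length_le_of_map (X' := T.graph) (g • ·)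
      (fun a b hab => Or.inr (T.adj_smul g a b hab)) w
    exact (SimpleGraph.dist_le w').trans (hw'.trans hw.le)
  exact le_antisymm (key g x y) (by simpa using key g⁻¹ (g • x) (g • y))

lemma mem_stab_smul_iff {g h : Γ} {x : T.V} : h ∈ T.stab (g • x) ↔ g⁻¹ * h * g ∈ T.stab x := by
  rw [MulAction.mem_stabilizer_iff, MulAction.mem_stabilizer_iff, mul_smul, mul_smul,
    inv_smul_eq_iff]

/-- The vertex stabilizers in an orbit are conjugate. -/
def stabEquivSmul (g : Γ) (x : T.V) : T.stab x ≃* T.stab (g • x) :=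
  ((T.stab x).equivSMul (MulAut.conj g)).trans
    (MulEquiv.subgroupCongr (MulAction.stabilizer_smul_eq_stabilizer_map_conj g x).symm)

/-- If a power of `g` fixes a vertex, then so does `g`: it fixes or inverts the center of a finite
orbit, and there are no inversions. -/
lemma exists_smul_eq_of_pow_smul_eq {g : Γ} {m : ℕ} (hm : m ≠ 0) {x : T.V} (h : g ^ m • x = x) :
    ∃ y : T.V, g • y = y := by
  have hfin : (Set.range fun i : ℤ => g ^ i • x).Finite := by
    refine (Set.finite_range fun i : Fin m => g ^ (i : ℕ) • x).subset ?_
    rintro _ ⟨i, rfl⟩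
    have hm' : (m : ℤ) ≠ 0 := by exact_mod_cast hm
    have h0 := Int.emod_nonneg i hm'
    have h1 := Int.emod_lt_of_pos i (b := m) (by omega)
    refine ⟨⟨(i % m).toNat, by omega⟩, ?_⟩
    have h2 : g ^ ((i % m).toNat) = g ^ (i % (m : ℤ)) := by
      rw [← zpow_natCast, Int.toNat_of_nonneg h0]
    have h3 : (g ^ m) ^ (i / (m : ℤ)) • x = x :=
      Subgroup.zpow_mem (MulAction.stabilizer Γ x) (MulAction.mem_stabilizer_iff.2 h) _
    have h4 : g ^ i = g ^ (i % (m : ℤ)) * (g ^ m) ^ (i / (m : ℤ)) := by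
      rw [← zpow_natCast g m, ← zpow_mul, ← zpow_add, Int.emod_add_mul_ediv]
    simp only
    rw [h2, h4, mul_smul, h3]
  obtain ⟨r, ⟨p, hp⟩, hr⟩ := T.isTree.exists_center (O := hfin.toFinset)
    ⟨x, by simpa using ⟨0, by simp⟩⟩
  have hstep : ∀ p, (∀ o ∈ hfin.toFinset, T.graph.dist p o ≤ r) →
      ∀ o ∈ hfin.toFinset, T.graph.dist (g • p) o ≤ r := by
    intro p hp o ho
    rw [Set.Finite.mem_toFinset] at ho
    obtain ⟨i, rfl⟩ := ho
    have := hp (g ^ (i - 1) • x) (by simp)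
    rwa [← T.dist_smul g, ← mul_smul, ← zpow_one_add, add_sub_cancel] at this
  have h1 := hr _ _ hp (hstep _ hp)
  have h2 := hr _ _ hp (hstep _ (hstep _ hp))
  have h3 := T.dist_smul g p (g • p)
  rcases Nat.lt_or_ge 0 (T.graph.dist p (g • p)) with h0 | h0
  · exfalso
    have hadj : T.graph.Adj p (g • p) := SimpleGraph.dist_eq_one_iff_adj.1 (by omega)
    have hne := T.isTree.dist_ne_of_adj p (T.adj_smul g _ _ hadj)
    refine T.not_inverted g _ _ hadj ⟨rfl, ?_⟩
    exact (T.isTree.connected.dist_eq_zero_iff.1 (by omega)).symm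
  · exact ⟨p, (T.isTree.connected.dist_eq_zero_iff.1 (by omega)).symm⟩

/-- The restriction of the action on a tree to a subgroup. -/
def restrict (H : Subgroup Γ) : GTree H where
  V := T.V
  graph := T.graph
  isTree := T.isTree
  adj_smul g := T.adj_smul g
  not_inverted g := T.not_inverted g

variable {T}

lemma not_isElliptic_restrict (hT : ¬ T.IsElliptic) (H : Subgroup Γ) [H.FiniteIndex] :
    ¬ (T.restrict H).IsElliptic := by
  intro h
  refine hT fun g => ?_
  obtain ⟨m, hm, -, hg⟩ := H.exists_pow_mem_of_index_ne_zero Subgroup.FiniteIndex.index_ne_zero g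
  obtain ⟨x, hx⟩ := h ⟨g ^ m, hg⟩
  exact T.exists_smul_eq_of_pow_smul_eq hm.ne' (x := x) hx

lemma isAcylindrical_restrict {k : ℕ} (hT : T.IsAcylindrical k) (H : Subgroup Γ) :
    (T.restrict H).IsAcylindrical k := by
  intro x y p hp hk
  have h1 : T.pathStab x y = ⊥ := hT x y p hp hk
  rw [eq_bot_iff]
  rintro ⟨g, hg⟩ ⟨hx, hy⟩
  have : g ∈ T.pathStab x y := ⟨hx, hy⟩
  rw [h1, Subgroup.mem_bot] at this
  exact Subgroup.mem_bot.2 (Subtype.ext this)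

end GTree

/-! ### Free abelian groups and volumes -/

lemma GroupVolume.weight_eq_of_mulEquiv (φ : GroupVolume.{u}) {Γ Δ : Type u} [Group Γ] [Group Δ]
    (e : Γ ≃* Δ) : φ.weight Γ = φ.weight Δ := by
  unfold GroupVolume.weight
  by_cases h : φ.mem Γ
  · rw [if_pos h, if_pos (φ.mem_of_mulEquiv Γ Δ ⟨e⟩ h), φ.vol_eq_of_mulEquiv Γ Δ ⟨e⟩ h]
  · rw [if_neg h, if_neg fun h' => h (φ.mem_of_mulEquiv Δ Γ ⟨e.symm⟩ h')]

lemma GroupVolume.weight_subgroup (φ : GroupVolume.{u}) {Γ : Type u} [Group Γ] (H : Subgroup Γ)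
    [H.FiniteIndex] (h : 0 < φ.weight Γ) : φ.weight H = H.index * φ.weight Γ := by
  unfold GroupVolume.weight at h ⊢
  have hm : φ.mem Γ := by
    by_contra hm
    simp [hm] at h
  rw [if_pos hm, if_pos (φ.mem_subgroup Γ H inferInstance hm), φ.vol_subgroup Γ H inferInstance hm]

/-- A group which embeds into a free abelian group of finite rank is free abelian of at most the
same rank. -/
lemma IsFreeAbelianOfRankLE.of_injective {n : ℕ} {Γ Δ : Type u} [Group Γ] [Group Δ]
    (h : IsFreeAbelianOfRankLE n Γ) (f : Δ →* Γ) (hf : Function.Injective f) :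
    IsFreeAbelianOfRankLE n Δ := by
  obtain ⟨m, hm, ⟨e⟩⟩ := h
  let F : Δ →* Multiplicative (Fin m → ℤ) := e.toMonoidHom.comp f
  have hF : Function.Injective F := e.injective.comp hf
  let N : Submodule ℤ (Fin m → ℤ) := AddSubgroup.toIntSubmodule (Subgroup.toAddSubgroup' F.range)
  obtain ⟨l, hl, b⟩ : ∃ l ≤ m, Nonempty (Module.Basis (Fin l) ℤ N) := by
    have b := Submodule.basisOfPid (Pi.basisFun ℤ (Fin m)) N
    refine ⟨_, ?_, ⟨b.2⟩⟩
    have := b.2.linearIndependent.map' N.subtype N.ker_subtype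
    simpa using this.fintype_card_le_finrank
  obtain ⟨b⟩ := b
  refine ⟨l, hl.trans hm, ⟨(MonoidHom.ofInjective hF).trans ?_⟩⟩
  have e2 : N ≃+ (Fin l → ℤ) := b.equivFun.toAddEquiv
  exact
    { toFun := fun x => Multiplicative.ofAdd (e2 ⟨Multiplicative.toAdd x.1, x.2⟩)
      invFun := fun y => ⟨Multiplicative.ofAdd (e2.symm (Multiplicative.toAdd y)).1,
        (e2.symm (Multiplicative.toAdd y)).2⟩
      left_inv := fun x => by simp
      right_inv := fun y => by simp
      map_mul' := fun x y => by
        rw [← ofAdd_add, ← map_add]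
        rfl }

lemma IsFreeAbelianOfRankLE.eq_one_of_finite {n : ℕ} {Γ : Type u} [Group Γ] [Finite Γ]
    (h : IsFreeAbelianOfRankLE n Γ) (g : Γ) : g = 1 := by
  obtain ⟨m, hm, ⟨e⟩⟩ := h
  have : Finite (Fin m → ℤ) := Finite.of_equiv Γ (e.toEquiv.trans Multiplicative.toAdd)
  apply e.injective
  rcases Nat.eq_zero_or_pos m with rfl | h0
  · exact Multiplicative.toAdd.injective (Subsingleton.elim _ _)
  · exfalso
    have : Nonempty (Fin m) := ⟨⟨0, h0⟩⟩
    exact not_finite (Fin m → ℤ)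

lemma GTree.hasFreeAbelianEdges_restrict {Γ : Type u} [Group Γ] {T : GTree Γ} {n : ℕ}
    (hT : T.HasFreeAbelianEdges n) (H : Subgroup Γ) : (T.restrict H).HasFreeAbelianEdges n := by
  intro x y hxy
  refine (hT x y hxy).of_injective
    ((H.subtype.comp (Subgroup.subtype _)).codRestrict _ fun g => g.2) ?_
  intro a b hab
  exact Subtype.ext (Subtype.ext (congrArg (fun z : T.pathStab x y => (z : Γ)) hab))

/-- A volume vanishes on nontrivial free abelian groups, as these are isomorphic to proper
subgroups of finite index. -/
lemma GroupVolume.weight_eq_zero {φ : GroupVolume.{u}} {n : ℕ} {Γ : Type u} [Group Γ] [Infinite Γ]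
    (h : IsFreeAbelianOfRankLE n Γ) : φ.weight Γ = 0 := by
  classical
  unfold GroupVolume.weight
  split_ifs with hmem
  swap
  · rfl
  obtain ⟨m, hm, ⟨e⟩⟩ := h
  have hm0 : 0 < m := by
    rcases Nat.eq_zero_or_pos m with rfl | h0
    · have := Finite.of_equiv _ (e.toEquiv.trans Multiplicative.toAdd).symm
      exact (not_finite Γ).elim
    · exact h0
  have hcomm : ∀ a b : Γ, a * b = b * a := fun a b => e.injective (by simp [mul_comm])
  let f : Γ →* Γ :=
    { toFun := fun a => a * a
      map_one' := by simp
      map_mul' := fun a b => by rw [mul_assoc, mul_assoc, ← mul_assoc b, hcomm b a, mul_assoc] }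
  have he : ∀ a, Multiplicative.toAdd (e (f a)) =
      Multiplicative.toAdd (e a) + Multiplicative.toAdd (e a) := fun a => by
    change Multiplicative.toAdd (e (a * a)) = _
    rw [map_mul]; rfl
  have hf : Function.Injective f := by
    intro a b hab
    apply e.injective
    apply Multiplicative.toAdd.injective
    have h1 := he a
    rw [hab, he b] at h1
    funext i
    have := congrFun h1 i
    simp only [Pi.add_apply] at this
    omega
  -- the index of the squares is finite, as they contain the kernel of the reduction modulo `2`
  let r : Γ →* Multiplicative (Fin m → ZMod 2) :=
    (AddMonoidHom.toMultiplicative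
      ((Int.castAddHom (ZMod 2)).compLeft (Fin m))).comp e.toMonoidHom
  have hr : r.ker ≤ f.range := by
    intro a ha
    have h1 : ∀ i, ((Multiplicative.toAdd (e a) i : ℤ) : ZMod 2) = 0 := fun i =>
      congrFun (congrArg Multiplicative.toAdd ha) i
    simp only [ZMod.intCast_zmod_eq_zero_iff_dvd] at h1
    choose c hc using h1
    refine ⟨e.symm (Multiplicative.ofAdd c), e.injective (Multiplicative.toAdd.injective ?_)⟩
    rw [he]
    funext i
    simp [hc i, two_mul]
  have hfin : f.range.FiniteIndex := Subgroup.finiteIndex_of_le hr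
  have hne : f.range ≠ ⊤ := by
    intro htop
    -- the vector all of whose coordinates are `1` is not divisible by `2`
    obtain ⟨a, ha⟩ : e.symm (Multiplicative.ofAdd (fun _ => 1)) ∈ f.range :=
      htop ▸ Subgroup.mem_top _
    have h1 := he a
    rw [ha] at h1
    have := congrFun h1 ⟨0, hm0⟩
    simp at this
    omega
  have h1 := φ.vol_subgroup Γ f.range hfin hmem
  rw [← φ.vol_eq_of_mulEquiv Γ f.range ⟨MonoidHom.ofInjective hf⟩ hmem] at h1
  have h2 : (2 : ℝ≥0) ≤ f.range.index := by
    have : 1 < f.range.index := Subgroup.one_lt_index_of_ne_top hne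
    exact_mod_cast this
  by_contra h0
  have h3 : 0 < φ.vol Γ := pos_iff_ne_zero.2 h0
  have h4 : 2 * φ.vol Γ ≤ f.range.index * φ.vol Γ := by gcongr
  rw [← h1, two_mul] at h4
  exact absurd h4 (not_le.2 (lt_add_of_pos_left _ h3))

/-! ### Infinite vertex stabilizers in one-ended groups -/

namespace GTree

variable {Γ : Type u} [Group Γ] {T : GTree Γ}

/-- If `b` fixes the endpoint `u` of the geodesic from `v` to `u`, but not the vertex before `u`,
then the geodesics from `v` to `u` and from `u` to `b • v` do not backtrack at `u`. -/
lemma dist_smul_eq_two_mul {u v c : T.V} {b : Γ} (hb : b • u = u) (hbc : b • c ≠ c)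
    (hcu : T.graph.Adj c u) (hc : T.graph.dist v c + T.graph.dist c u = T.graph.dist v u) :
    T.graph.dist v (b • v) = 2 * T.graph.dist v u := by
  have hX := T.isTree
  have hcm : ∀ x y, T.graph.dist x y = T.graph.dist y x := fun x y => T.graph.dist_comm
  have htr : ∀ x y z, T.graph.dist x z ≤ T.graph.dist x y + T.graph.dist y z := fun x y z =>
    hX.connected.dist_triangle
  have h1 : T.graph.dist c u = 1 := SimpleGraph.dist_eq_one_iff_adj.2 hcu
  have hbcu : T.graph.dist (b • c) u = 1 := by rw [← h1, ← T.dist_smul b c u, hb]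
  have hbvu : T.graph.dist (b • v) u = T.graph.dist v u := by rw [← T.dist_smul b v u, hb]
  have hbvc : T.graph.dist (b • v) (b • c) = T.graph.dist v c := T.dist_smul b v c
  have hne : T.graph.dist c (b • c) ≠ 0 := fun h =>
    hbc (hX.connected.dist_eq_zero_iff.1 h).symm
  -- both `c` and `b • c` lie on the geodesic from `v` to `b • v`
  have key1 : T.graph.dist v c + T.graph.dist c (b • v) = T.graph.dist v (b • v) := by
    rcases hX.between_or_between hc (b • v) with h | h
    · exact h
    · refine absurd (hX.eq_of_between h (m' := b • c) ?_ ?_) hbc.symm <;> omega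
  have key2 : T.graph.dist v (b • c) + T.graph.dist (b • c) (b • v) = T.graph.dist v (b • v) := by
    rcases hX.between_or_between (p := b • v) (q := u) (m := b • c) (by omega) v with h | h
    · have := hcm v (b • c); have := hcm (b • c) (b • v); have := hcm v (b • v)
      omega
    · refine absurd (hX.eq_of_between h (m' := c) ?_ ?_) hbc
      · omega
      · omega
  have := hcm (b • c) (b • v)
  have := hcm c (b • c)
  have := hcm u (b • c)
  have := hcm u (b • v)
  have h2 := htr c u (b • c)
  have h3 : T.graph.dist c (b • c) ≠ 1 := by
    intro h
    have hadj : T.graph.Adj c (b • c) := SimpleGraph.dist_eq_one_iff_adj.1 h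
    have := hX.dist_ne_of_adj u hadj
    have := hcm u c
    omega
  have h4 := htr (b • v) c u
  have h5 := htr c u (b • v)
  have h6 := htr v u (b • v)
  have h7 := hcm c (b • v)
  rcases hX.between_or_between key1 (b • c) with h | h <;> omega

/-- Let a one-ended group act on a tree with some hyperbolic element. Then a nontrivial vertex
stabilizer is infinite, if its finiteness would force the incident edges to have trivial
stabilizers. Otherwise an incident edge would cut the orbit of the vertex, and so the group, into
two infinite parts with finite coboundary. -/
lemma infinite_stab (hG : IsOneEnded Γ) (hT : ¬ T.IsElliptic) {v : T.V} (hv : T.stab v ≠ ⊥)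
    (hfree : Finite (T.stab v) → ∀ w, T.graph.Adj v w → T.pathStab v w = ⊥) :
    Infinite (T.stab v) := by
  by_contra hfin
  rw [not_infinite_iff_finite] at hfin
  have hX := T.isTree
  have hcm : ∀ x y, T.graph.dist x y = T.graph.dist y x := fun x y => T.graph.dist_comm
  have htr : ∀ x y z, T.graph.dist x z ≤ T.graph.dist x y + T.graph.dist y z := fun x y z =>
    hX.connected.dist_triangle
  obtain ⟨a, ha1⟩ := Subgroup.ne_bot_iff_exists_ne_one.1 hv
  have hfix : ∀ w, T.graph.Adj v w → (a : Γ) • w ≠ w := by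
    intro w hw h
    have : (a : Γ) ∈ T.pathStab v w := ⟨a.2, h⟩
    rw [hfree hfin w hw, Subgroup.mem_bot] at this
    exact ha1 (Subtype.ext this)
  obtain ⟨h, hh⟩ : ∃ h : Γ, h • v ≠ v := by
    by_contra! hcon
    exact hT fun g => ⟨v, hcon g⟩
  have hpos := hX.connected.pos_dist_of_ne hh.symm
  obtain ⟨w, hw1, hw2⟩ := hX.connected.exists_between v (h • v) (i := 1) hpos
  have hvw : T.graph.Adj v w := SimpleGraph.dist_eq_one_iff_adj.1 hw1
  -- the elements moving `v` beyond the edge from `v` to `w`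
  let A : Set Γ := {g | 1 + T.graph.dist w (g • v) = T.graph.dist v (g • v)}
  have hdouble : ∀ g ∈ A, ∃ g' ∈ A, T.graph.dist v (g • v) < T.graph.dist v (g' • v) := by
    intro g hg
    have hg' : 1 + T.graph.dist w (g • v) = T.graph.dist v (g • v) := hg
    obtain ⟨c, hc1, hc2⟩ := hX.connected.exists_between (g • v) v (i := 1) (by rw [hcm]; omega)
    have hgc : T.graph.Adj v (g⁻¹ • c) := by
      rw [← T.adj_smul_iff g, smul_inv_smul]
      exact SimpleGraph.dist_eq_one_iff_adj.1 hc1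
    have := hcm c v
    have := hcm c (g • v)
    have := hcm v (g • v)
    have hb : (g * a * g⁻¹) • g • v = g • v := by
      rw [mul_smul, inv_smul_smul, mul_smul, show (a : Γ) • v = v from a.2]
    have hd := dist_smul_eq_two_mul (T := T) (u := g • v) (v := v) (c := c) (b := g * a * g⁻¹)
      hb
      (by
        intro h
        rw [mul_smul, mul_smul, ← eq_inv_smul_iff] at h
        exact hfix _ hgc h)
      (SimpleGraph.dist_eq_one_iff_adj.1 (by omega)) (by omega)
    refine ⟨g * a * g⁻¹, ?_, by omega⟩
    have h1 := htr w (g • v) ((g * a * g⁻¹) • v)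
    have h2 := htr v w ((g * a * g⁻¹) • v)
    have h3 : T.graph.dist (g • v) ((g * a * g⁻¹) • v) = T.graph.dist (g • v) v := by
      have := T.dist_smul (g * a * g⁻¹) (g • v) v
      rwa [hb] at this
    change 1 + T.graph.dist w ((g * a * g⁻¹) • v) = _
    omega
  have hA : A.Infinite := by
    intro hAf
    obtain ⟨g, hg, hmax⟩ := Set.exists_max_image A (fun g => T.graph.dist v (g • v)) hAf
      ⟨h, by change 1 + T.graph.dist w (h • v) = _; omega⟩
    obtain ⟨g', hg', hlt⟩ := hdouble g hg
    exact absurd (hmax g' hg') (not_le.2 hlt)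
  -- the element `a` moves this set off itself
  have hAc : Aᶜ.Infinite := by
    refine (hA.image (mul_right_injective (a : Γ)).injOn).mono ?_
    rintro _ ⟨g, hg, rfl⟩ hg'
    have hg1 : 1 + T.graph.dist w (g • v) = T.graph.dist v (g • v) := hg
    have hg2 : 1 + T.graph.dist w ((a * g : Γ) • v) = T.graph.dist v ((a * g : Γ) • v) := hg'
    have hav : (a : Γ) • v = v := a.2
    have h1 : T.graph.dist v ((a : Γ) • w) = 1 := by rw [← hw1, ← T.dist_smul a v w, hav]
    have h2 : T.graph.dist ((a : Γ) • w) ((a * g : Γ) • v) = T.graph.dist w (g • v) := by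
      rw [mul_smul, T.dist_smul]
    have h3 : T.graph.dist v ((a * g : Γ) • v) = T.graph.dist v (g • v) := by
      rw [← T.dist_smul a v (g • v), hav, mul_smul]
    exact hfix w hvw (hX.eq_of_between (p := v) (q := (a * g : Γ) • v) (by omega) (by omega)
      (by omega))
  refine hG.not_infinite_compl hA (fun s => ?_) hAc
  -- if `g` is in the set, but `g * s` is not, then `v` separates `g • v` from `(g * s) • v`
  obtain ⟨p⟩ := hX.connected v (s • v)
  have hfib : ∀ x : T.V, {g : Γ | g⁻¹ • v = x}.Finite := by
    intro x
    rcases Set.eq_empty_or_nonempty {g : Γ | g⁻¹ • v = x} with h0 | ⟨g₀, hg₀⟩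
    · rw [h0]; exact Set.finite_empty
    · have : (T.stab v : Set Γ).Finite := Set.toFinite _
      refine (this.image (· * g₀)).subset fun g hg => ⟨g * g₀⁻¹, ?_, by simp⟩
      have hg' : g⁻¹ • v = x := hg
      have hg₀' : g₀⁻¹ • v = x := hg₀
      change (g * g₀⁻¹) • v = v
      rw [mul_smul, hg₀', ← hg', smul_inv_smul]
  refine (Set.Finite.biUnion (List.finite_toSet p.support) fun x _ => hfib x).subset ?_
  rintro g ⟨hg, hgs⟩
  refine Set.mem_biUnion (x := g⁻¹ • v) ?_ rfl
  have hg1 : 1 + T.graph.dist w (g • v) = T.graph.dist v (g • v) := hg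
  have hg2 : ¬ (1 + T.graph.dist w ((g * s) • v) = T.graph.dist v ((g * s) • v)) := hgs
  apply hX.mem_support_of_dist_add_dist
  have e1 : T.graph.dist v (g⁻¹ • v) = T.graph.dist (g • v) v := by
    rw [← T.dist_smul g v (g⁻¹ • v), smul_inv_smul]
  have e2 : T.graph.dist (g⁻¹ • v) (s • v) = T.graph.dist v ((g * s) • v) := by
    rw [← T.dist_smul g (g⁻¹ • v) (s • v), smul_inv_smul, mul_smul]
  have e3 : T.graph.dist v (s • v) = T.graph.dist (g • v) ((g * s) • v) := by
    rw [← T.dist_smul g v (s • v), mul_smul]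
  rw [e1, e2, e3]
  have h1 := hX.between_or_between (p := v) (q := g • v) (m := w) (by omega) ((g * s) • v)
  have h2 := hX.dist_eq_dist_add_one_of_adj ((g * s) • v) hvw
  have := hcm v (g • v)
  have := hcm w (g • v)
  have := hcm v ((g * s) • v)
  have := hcm w ((g * s) • v)
  have := hcm (g • v) ((g * s) • v)
  have := htr (g • v) v ((g * s) • v)
  omega

end GTree

/-! ### Invariant subtrees and collapses -/

namespace GTree

variable {Γ : Type u} [Group Γ] {T : GTree Γ}

/-- A reduction of the `Γ`-tree `T` to a `Γ`-tree `T'`, whose vertices are some of the vertices of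
`T`: distances do not increase, and the edge groups of `T'` are among those of `T`. Invariant
subtrees and the results of collapsing suitable edges are of this kind. -/
structure Reduction (T T' : GTree Γ) where
  /-- the inclusion of the vertices -/
  toFun : T'.V → T.V
  injective : Function.Injective toFun
  map_smul : ∀ (g : Γ) (p : T'.V), toFun (g • p) = g • toFun p
  dist_le : ∀ p q, T'.graph.dist p q ≤ T.graph.dist (toFun p) (toFun q)
  exists_pathStab_eq : ∀ p q, T'.graph.Adj p q →
    ∃ a b, T.graph.Adj a b ∧ T'.pathStab p q = T.pathStab a b

namespace Reduction

variable {T' : GTree Γ} (r : Reduction T T')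
include r

lemma stab_eq (p : T'.V) : T'.stab p = T.stab (r.toFun p) := by
  ext g
  rw [MulAction.mem_stabilizer_iff, MulAction.mem_stabilizer_iff, ← r.map_smul, r.injective.eq_iff]

lemma isAcylindrical {k : ℕ} (h : T.IsAcylindrical k) : T'.IsAcylindrical k := by
  intro p q w hw hk
  obtain ⟨w', hw', hl⟩ := T.isTree.connected.exists_path_of_dist (r.toFun p) (r.toFun q)
  have h1 := r.dist_le p q
  have h2 := T'.isTree.length_eq_dist hw
  have := h _ _ w' hw' (by omega)
  simpa only [pathStab, r.stab_eq] using this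

lemma hasFreeAbelianEdges {n : ℕ} (h : T.HasFreeAbelianEdges n) : T'.HasFreeAbelianEdges n := by
  intro p q hpq
  obtain ⟨a, b, hab, e⟩ := r.exists_pathStab_eq p q hpq
  rw [e]
  exact h a b hab

lemma not_isElliptic (h : ¬ T.IsElliptic) : ¬ T'.IsElliptic := by
  refine fun h' => h fun g => ?_
  obtain ⟨p, hp⟩ := h' g
  exact ⟨r.toFun p, by rw [← r.map_smul, hp]⟩

lemma mem_orbit_iff {p q : T'.V} :
    r.toFun q ∈ MulAction.orbit Γ (r.toFun p) ↔ q ∈ MulAction.orbit Γ p := by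
  simp only [MulAction.mem_orbit_iff, ← r.map_smul, r.injective.eq_iff]

end Reduction

/-- An invariant set of vertices of a tree that spans a connected subgraph is an invariant
subtree. -/
def subtree (T : GTree Γ) (Y : SubMulAction Γ T.V)
    (hY : (T.graph.induce (Y : Set T.V)).Connected) : GTree Γ where
  V := Y
  graph := T.graph.induce (Y : Set T.V)
  isTree := ⟨hY, T.isTree.isAcyclic.induce _⟩
  adj_smul g _ _ h := T.adj_smul g _ _ h
  not_inverted g _ _ h h' := T.not_inverted g _ _ h
    ⟨congrArg Subtype.val h'.1, congrArg Subtype.val h'.2⟩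

/-- An invariant subtree is a reduction. -/
def subtreeReduction (T : GTree Γ) (Y : SubMulAction Γ T.V)
    (hY : (T.graph.induce (Y : Set T.V)).Connected) : Reduction T (T.subtree Y hY) where
  toFun := fun y : Y => (y : T.V)
  injective := Subtype.val_injective
  map_smul _ _ := rfl
  dist_le p q := by
    obtain ⟨w, hw, hl⟩ := hY.exists_path_of_dist p q
    let f := (SimpleGraph.Embedding.induce (G := T.graph) (Y : Set T.V)).toHom
    have h1 := T.isTree.length_eq_dist (hw.map (f := f) Subtype.val_injective)
    exact (hl.symm.trans ((w.length_map f).symm.trans h1)).le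
  exists_pathStab_eq p q h := by
    refine ⟨_, _, h, ?_⟩
    ext g
    exact and_congr Subtype.ext_iff Subtype.ext_iff

/-- For a finitely generated group, every finite set of vertices is contained in an invariant
subtree with finite quotient. -/
lemma exists_subtree [Group.FG Γ] (T : GTree Γ) {F : Set T.V} (hF : F.Finite) :
    ∃ (T' : GTree Γ) (r : Reduction T T'), Finite (MulAction.orbitRel.Quotient Γ T'.V) ∧
      F ⊆ Set.range r.toFun := by
  obtain ⟨S, hS⟩ := Group.FG.out (G := Γ)
  obtain ⟨v₀⟩ := T.isTree.connected.nonempty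
  -- join a base vertex to `F` and to its translates by the generators by walks
  let F' : Set T.V := insert v₀ (F ∪ (fun s : Γ => s • v₀) '' S)
  have hF' : F'.Finite := (hF.union (S.finite_toSet.image _)).insert _
  have w : ∀ f : T.V, T.graph.Walk v₀ f := fun f => (T.isTree.connected v₀ f).some
  let C : Set T.V := ⋃ f ∈ F', {z | z ∈ (w f).support}
  have hC : C.Finite := hF'.biUnion fun f _ => List.finite_toSet _
  let Y : SubMulAction Γ T.V :=
    { carrier := {z | ∃ g : Γ, ∃ c ∈ C, g • c = z}
      smul_mem' := by
        rintro h _ ⟨g, c, hc, rfl⟩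
        exact ⟨h * g, c, hc, mul_smul _ _ _⟩ }
  have hCY : C ⊆ Y := fun c hc => ⟨1, c, hc, one_smul _ _⟩
  -- vertices joined by a walk inside the translates of the chosen walks
  let P : T.V → T.V → Prop := fun z z' => ∃ p : T.graph.Walk z z', ∀ u ∈ p.support, u ∈ Y
  have hPtrans : ∀ {a b c}, P a b → P b c → P a c := by
    rintro a b c ⟨p, hp⟩ ⟨q, hq⟩
    refine ⟨p.append q, fun u hu => ?_⟩
    rw [SimpleGraph.Walk.mem_support_append_iff] at hu
    exact hu.elim (hp u) (hq u)
  have hPsymm : ∀ {a b}, P a b → P b a := by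
    rintro a b ⟨p, hp⟩
    exact ⟨p.reverse, fun u hu => hp u (by simpa using hu)⟩
  have hPsmul : ∀ (g : Γ) {a b}, P a b → P (g • a) (g • b) := by
    rintro g a b ⟨p, hp⟩
    let φ : T.graph →g T.graph := ⟨(g • ·), fun h => T.adj_smul g _ _ h⟩
    refine ⟨p.map φ, fun u hu => ?_⟩
    rw [SimpleGraph.Walk.support_map, List.mem_map] at hu
    obtain ⟨z, hz, rfl⟩ := hu
    exact Y.smul_mem g (hp z hz)
  have hPC : ∀ c ∈ C, P v₀ c := by
    classical
    intro c hc
    obtain ⟨f, hf, hcf⟩ := Set.mem_iUnion₂.1 hc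
    exact ⟨(w f).takeUntil c hcf, fun u hu => hCY (Set.mem_biUnion hf
      ((w f).support_takeUntil_subset_support hcf hu))⟩
  have hF'C : F' ⊆ C := fun f hf => Set.mem_biUnion hf (w f).end_mem_support
  have hPg : ∀ g : Γ, P v₀ (g • v₀) := by
    intro g
    have hg : g ∈ Subgroup.closure (S : Set Γ) := hS ▸ Subgroup.mem_top g
    induction hg using Subgroup.closure_induction with
    | mem s hs => exact hPC _ (hF'C (Or.inr (Or.inr ⟨s, hs, rfl⟩)))
    | one => simpa using hPC v₀ (hF'C (Or.inl rfl))
    | mul a b _ _ iha ihb => rw [mul_smul]; exact hPtrans iha (hPsmul a ihb)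
    | inv a _ ih => simpa using hPsymm (hPsmul a⁻¹ ih)
  have hPY : ∀ y ∈ Y, P v₀ y := by
    rintro _ ⟨g, c, hc, rfl⟩
    exact hPtrans (hPg g) (hPsmul g (hPC c hc))
  have hY : (T.graph.induce (Y : Set T.V)).Connected := by
    have : Nonempty (Y : Set T.V) := ⟨⟨v₀, hCY (hF'C (Or.inl rfl))⟩⟩
    refine SimpleGraph.Connected.mk fun a b => ?_
    obtain ⟨p, hp⟩ := hPtrans (hPsymm (hPY a a.2)) (hPY b b.2)
    exact (p.induce (Y : Set T.V) hp).reachable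
  refine ⟨T.subtree Y hY, T.subtreeReduction Y hY, ?_, fun f hf => ?_⟩
  · have := hC.to_subtype
    refine Finite.of_surjective (α := C) (fun c => (T.subtree Y hY).toQuot ⟨c, hCY c.2⟩) fun o => ?_
    obtain ⟨⟨_, g, c, hc, rfl⟩, rfl⟩ := Quotient.exists_rep o
    refine ⟨⟨c, hc⟩, Quotient.sound ⟨g⁻¹, Subtype.ext ?_⟩⟩
    exact inv_smul_smul g c
  · exact ⟨⟨f, hCY (hF'C (Or.inr (Or.inl hf)))⟩, rfl⟩

section collapse

variable {Y : SubMulAction Γ T.V} {ρ : T.V → Y}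

/-- Deleting an edge which is not collapsed by a retraction does not separate a vertex from its
image. -/
lemma reachable_deleteEdges_retract (hρY : ∀ y : Y, ρ y = y)
    (hρ : ∀ z : T.V, (ρ z : T.V) = z ∨ T.graph.Adj z (ρ z)) {a b : T.V} (hab : ρ a ≠ ρ b)
    (z : T.V) : (T.graph.deleteEdges {s(a, b)}).Reachable z (ρ z) := by
  rcases hρ z with h | h
  · rw [h]
  · refine SimpleGraph.Adj.reachable ?_
    rw [SimpleGraph.deleteEdges_adj]
    refine ⟨h, fun he => hab ?_⟩
    rw [Set.mem_singleton_iff, Sym2.eq_iff] at he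
    rcases he with ⟨rfl, h2⟩ | ⟨rfl, h2⟩
    · rw [← h2, hρY]
    · rw [← h2, hρY]

lemma not_reachable_deleteEdges {a b : T.V} (hab : T.graph.Adj a b) :
    ¬ (T.graph.deleteEdges {s(a, b)}).Reachable a b :=
  SimpleGraph.isBridge_iff.1
    (SimpleGraph.isAcyclic_iff_forall_adj_isBridge.1 T.isTree.isAcyclic hab)

/-- An edge which is not collapsed is determined by its image. -/
lemma eq_and_eq_of_retract_eq (hρY : ∀ y : Y, ρ y = y)
    (hρ : ∀ z : T.V, (ρ z : T.V) = z ∨ T.graph.Adj z (ρ z)) {a b a' b' : T.V}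
    (h : T.graph.Adj a b) (h' : T.graph.Adj a' b') (hab : ρ a ≠ ρ b) (ha : ρ a' = ρ a)
    (hb : ρ b' = ρ b) : a' = a ∧ b' = b := by
  have key := reachable_deleteEdges_retract hρY hρ hab
  by_cases he : s(a', b') = s(a, b)
  · rw [Sym2.eq_iff] at he
    rcases he with he | ⟨rfl, rfl⟩
    · exact he
    · exact absurd ha.symm hab
  · have h1 : (T.graph.deleteEdges {s(a, b)}).Reachable a' b' :=
      SimpleGraph.Adj.reachable (SimpleGraph.deleteEdges_adj.2 ⟨h', he⟩)
    have ha' := key a'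
    have hb' := key b'
    rw [ha] at ha'
    rw [hb] at hb'
    exact absurd ((key a).trans (ha'.symm.trans (h1.trans (hb'.trans (key b).symm))))
      (not_reachable_deleteEdges h)

/-- The image of the tree under a map of its vertices, without the loops coming from the collapsed
edges. -/
def imageGraph (T : GTree Γ) {W : Type u} (ρ : T.V → W) : SimpleGraph W where
  Adj p q := p ≠ q ∧ ∃ a b, T.graph.Adj a b ∧ ρ a = p ∧ ρ b = q
  symm := ⟨fun _ _ ⟨h, a, b, hab, ha, hb⟩ => ⟨h.symm, b, a, hab.symm, hb, ha⟩⟩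
  loopless := ⟨fun _ h => h.1 rfl⟩

lemma exists_walk_imageGraph_length_le {W : Type u} (ρ : T.V → W) {a b : T.V}
    (w : T.graph.Walk a b) : ∃ w' : (T.imageGraph ρ).Walk (ρ a) (ρ b), w'.length ≤ w.length :=
  SimpleGraph.exists_walk_length_le_of_map (X' := T.imageGraph ρ) ρ
    (fun a b hab => or_iff_not_imp_left.2 fun hne => ⟨hne, a, b, hab, rfl, rfl⟩) w

/-- The tree obtained by collapsing all edges between a vertex and its image under an equivariant
retraction, where the vertices of the new tree are the fixed points of the retraction. -/
def collapse (T : GTree Γ) {Y : SubMulAction Γ T.V} (ρ : T.V → Y) (hρY : ∀ y : Y, ρ y = y)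
    (hρ : ∀ z : T.V, (ρ z : T.V) = z ∨ T.graph.Adj z (ρ z))
    (hρs : ∀ (g : Γ) (z : T.V), ρ (g • z) = g • ρ z) : GTree Γ where
  V := Y
  graph := T.imageGraph ρ
  isTree := by
    refine ⟨?_, ?_⟩
    · obtain ⟨v₀⟩ := T.isTree.connected.nonempty
      have : Nonempty Y := ⟨ρ v₀⟩
      refine SimpleGraph.Connected.mk fun p q => ?_
      obtain ⟨w⟩ := T.isTree.connected p q
      obtain ⟨w', -⟩ := exists_walk_imageGraph_length_le ρ w
      rw [hρY, hρY] at w'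
      exact ⟨w'⟩
    · rw [SimpleGraph.isAcyclic_iff_forall_adj_isBridge]
      rintro _ _ ⟨hne, a, b, hab, rfl, rfl⟩
      rw [SimpleGraph.isBridge_iff]
      rintro ⟨w⟩
      -- a detour around an edge lifts to a detour around the edge of `T` above it
      have key := reachable_deleteEdges_retract hρY hρ hne
      have hlift : ∀ p q : Y, ∀ w : ((T.imageGraph ρ).deleteEdges {s(ρ a, ρ b)}).Walk p q,
          (T.graph.deleteEdges {s(a, b)}).Reachable p q := by
        intro p q w
        induction w with
        | nil => exact SimpleGraph.Reachable.refl _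
        | cons h _ ih =>
          refine SimpleGraph.Reachable.trans ?_ ih
          obtain ⟨⟨-, a', b', hab', rfl, rfl⟩, he⟩ := SimpleGraph.deleteEdges_adj.1 h
          refine (key a').symm.trans (SimpleGraph.Reachable.trans ?_ (key b'))
          refine SimpleGraph.Adj.reachable (SimpleGraph.deleteEdges_adj.2 ⟨hab', fun he' => he ?_⟩)
          exact congrArg (Sym2.map ρ) he'
      exact not_reachable_deleteEdges hab ((key a).trans ((hlift _ _ w).trans (key b).symm))
  adj_smul := by
    rintro g _ _ ⟨hne, a, b, hab, rfl, rfl⟩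
    exact ⟨fun h => hne (MulAction.injective g h), g • a, g • b, T.adj_smul g _ _ hab, hρs _ _,
      hρs _ _⟩
  not_inverted := by
    rintro g _ _ ⟨hne, a, b, hab, rfl, rfl⟩ ⟨h1, h2⟩
    rw [← hρs] at h1 h2
    obtain ⟨e1, e2⟩ := eq_and_eq_of_retract_eq hρY hρ hab (T.adj_smul g _ _ hab.symm) hne h2 h1
    exact T.not_inverted g _ _ hab ⟨e2, e1⟩

/-- Collapsing along an equivariant retraction is a reduction. -/
def collapseReduction (T : GTree Γ) {Y : SubMulAction Γ T.V} (ρ : T.V → Y)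
    (hρY : ∀ y : Y, ρ y = y) (hρ : ∀ z : T.V, (ρ z : T.V) = z ∨ T.graph.Adj z (ρ z))
    (hρs : ∀ (g : Γ) (z : T.V), ρ (g • z) = g • ρ z) :
    Reduction T (T.collapse ρ hρY hρ hρs) where
  toFun := fun y : Y => (y : T.V)
  injective := Subtype.val_injective
  map_smul _ _ := rfl
  dist_le := fun (p q : Y) => by
    obtain ⟨w, hw⟩ := T.isTree.connected.exists_walk_length_eq_dist (p : T.V) (q : T.V)
    obtain ⟨w', hw'⟩ := exists_walk_imageGraph_length_le ρ w
    have h1 := (SimpleGraph.dist_le w').trans (hw'.trans hw.le)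
    rwa [hρY, hρY] at h1
  exists_pathStab_eq := by
    rintro _ _ ⟨hne, a, b, hab, rfl, rfl⟩
    refine ⟨a, b, hab, ?_⟩
    ext g
    constructor
    · rintro ⟨h1, h2⟩
      have h1' : g • ρ a = ρ a := h1
      have h2' : g • ρ b = ρ b := h2
      rw [← hρs] at h1' h2'
      exact eq_and_eq_of_retract_eq hρY hρ hab (T.adj_smul g _ _ hab) hne h1' h2'
    · rintro ⟨h1, h2⟩
      have h1' : g • a = a := h1
      have h2' : g • b = b := h2
      have h3 := hρs g a
      have h4 := hρs g b
      rw [h1'] at h3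
      rw [h2'] at h4
      exact ⟨h3.symm, h4.symm⟩

end collapse

/-- If the stabilizer of a vertex `x` is contained in the one of an adjacent, inequivalent vertex,
then the orbit of `x` can be removed from the tree, by collapsing the edge to that vertex. -/
lemma exists_reduction_of_stab_le {x y : T.V} (hxy : T.graph.Adj x y)
    (hy : y ∉ MulAction.orbit Γ x) (hle : T.stab x ≤ T.stab y) :
    ∃ (T' : GTree Γ) (r : Reduction T T'), Set.range r.toFun = (MulAction.orbit Γ x)ᶜ := by
  classical
  let Y : SubMulAction Γ T.V :=
    { carrier := (MulAction.orbit Γ x)ᶜ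
      smul_mem' := fun g z hz h => hz (by simpa using MulAction.mem_orbit_of_mem_orbit g⁻¹ h) }
  have hyY : ∀ g : Γ, g • y ∈ Y := fun g => Y.smul_mem g hy
  let ρ : T.V → Y := fun z =>
    if h : z ∈ MulAction.orbit Γ x then ⟨h.choose • y, hyY _⟩ else ⟨z, h⟩
  have hρx : ∀ g : Γ, ρ (g • x) = ⟨g • y, hyY g⟩ := by
    intro g
    have h : g • x ∈ MulAction.orbit Γ x := ⟨g, rfl⟩
    have hs : h.choose • x = g • x := h.choose_spec
    change dite _ _ _ = _
    rw [dif_pos h]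
    refine Subtype.ext ?_
    have h2 : g⁻¹ * h.choose ∈ T.stab y := hle (by
      rw [MulAction.mem_stabilizer_iff, mul_smul, hs, inv_smul_smul])
    rw [MulAction.mem_stabilizer_iff, mul_smul, inv_smul_eq_iff] at h2
    exact h2
  have hρY : ∀ y : Y, ρ y = y := fun y => dif_neg y.2
  have hρ : ∀ z : T.V, (ρ z : T.V) = z ∨ T.graph.Adj z (ρ z) := by
    intro z
    by_cases h : z ∈ MulAction.orbit Γ x
    · obtain ⟨g, rfl⟩ := h
      right
      change T.graph.Adj (g • x) (ρ (g • x))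
      rw [hρx]
      exact T.adj_smul g _ _ hxy
    · left
      exact congrArg Subtype.val (hρY ⟨z, h⟩)
  have hρs : ∀ (g : Γ) (z : T.V), ρ (g • z) = g • ρ z := by
    intro g z
    by_cases h : z ∈ MulAction.orbit Γ x
    · obtain ⟨h, rfl⟩ := h
      change ρ (g • h • x) = g • ρ (h • x)
      rw [← mul_smul, hρx, hρx]
      exact Subtype.ext (mul_smul _ _ _)
    · have h1 := hρY ⟨z, h⟩
      have h2 := hρY (g • ⟨z, h⟩)
      exact h2.trans (congrArg (g • ·) h1.symm)
  exact ⟨T.collapse ρ hρY hρ hρs, T.collapseReduction ρ hρY hρ hρs, Subtype.range_val⟩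

/-- A cocompact acylindrical tree with free abelian edge groups can be reduced, without losing the
vertices whose stabilizers are not free abelian of small rank. -/
lemma exists_isReduced {k n : ℕ} (hacyl : T.IsAcylindrical k) (hedge : T.HasFreeAbelianEdges n)
    [hfin : Finite (MulAction.orbitRel.Quotient Γ T.V)] {ι : Type u} (x : ι → T.V)
    (hT : ¬ T.IsElliptic)
    (hx : ∀ i j, x j ∈ MulAction.orbit Γ (x i) → i = j)
    (hab : ∀ i, ¬ IsFreeAbelianOfRankLE n (T.stab (x i))) :
    ∃ T' : GTree Γ, (T'.IsReduced ∧ T'.IsAcylindrical k ∧ T'.HasFreeAbelianEdges n) ∧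
      ¬ T'.IsElliptic ∧ ∃ x' : ι → T'.V,
        (∀ i j, x' j ∈ MulAction.orbit Γ (x' i) → i = j) ∧
        ∀ i, T'.stab (x' i) = T.stab (x i) := by
  induction hN : Nat.card (MulAction.orbitRel.Quotient Γ T.V) using Nat.strong_induction_on
    generalizing T with
  | _ N ih =>
  by_cases hred : T.IsReduced
  · exact ⟨T, ⟨hred, hacyl, hedge⟩, hT, x, hx, fun _ => rfl⟩
  obtain ⟨a, b, hadj, hb, hle⟩ : ∃ a b, T.graph.Adj a b ∧ b ∉ MulAction.orbit Γ a ∧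
      T.pathStab a b = T.stab a := by
    simp only [IsReduced, not_forall, not_and_or] at hred
    obtain ⟨a, b, hadj, hb, h | h⟩ := hred
    · exact ⟨a, b, hadj, hb, eq_of_le_of_not_lt inf_le_left h⟩
    · refine ⟨b, a, hadj.symm, fun h' => hb (MulAction.mem_orbit_symm.1 h'), ?_⟩
      exact eq_of_le_of_not_lt inf_le_left (by rwa [pathStab, inf_comm])
  obtain ⟨T', r, hr⟩ := exists_reduction_of_stab_le hadj hb (inf_eq_left.1 hle)
  have hxr : ∀ i, ∃ p, r.toFun p = x i := by
    intro i
    change x i ∈ Set.range r.toFun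
    rw [hr]
    rintro ⟨g, hg⟩
    refine hab i ?_
    have h1 : IsFreeAbelianOfRankLE n (T.stab a) := hle ▸ hedge a b hadj
    rw [← hg]
    exact h1.of_injective (T.stabEquivSmul g a).symm.toMonoidHom
      (T.stabEquivSmul g a).symm.injective
  choose x' hx' using hxr
  -- the orbits of `T'` are those of `T`, except for the orbit of `a`
  let f : MulAction.orbitRel.Quotient Γ T'.V → MulAction.orbitRel.Quotient Γ T.V :=
    Quotient.map r.toFun fun p q h => r.mem_orbit_iff.2 h
  have hf : Function.Injective f := by
    intro o o' h
    induction o using Quotient.inductionOn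
    induction o' using Quotient.inductionOn
    exact Quotient.sound (r.mem_orbit_iff.1 (Quotient.exact h))
  have hfa : ¬ Function.Surjective f := by
    intro hs
    obtain ⟨o, ho⟩ := hs (T.toQuot a)
    induction o using Quotient.inductionOn with
    | _ p =>
    have h1 : r.toFun p ∈ (MulAction.orbit Γ a)ᶜ := hr ▸ ⟨p, rfl⟩
    exact h1 (Quotient.exact ho)
  have hfin' := Finite.of_injective f hf
  have hcard : Nat.card (MulAction.orbitRel.Quotient Γ T'.V) < N := by
    rw [← hN]
    refine lt_of_le_of_ne (Nat.card_le_card_of_injective f hf) fun h => hfa ?_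
    exact ((Nat.bijective_iff_injective_and_card f).2 ⟨hf, h⟩).2
  obtain ⟨T'', h1, h2, x'', h3, h4⟩ := ih _ hcard (r.isAcylindrical hacyl)
    (r.hasFreeAbelianEdges hedge) x' (r.not_isElliptic hT)
    (fun i j h => hx i j (by rw [← hx', ← hx']; exact r.mem_orbit_iff.2 h))
    (fun i => by rw [r.stab_eq, hx']; exact hab i) rfl
  exact ⟨T'', h1, h2, x'', h3, fun i => by rw [h4, r.stab_eq, hx']⟩

end GTree

/-! ### Lower bounds for the complexity -/

namespace GTree

variable {Γ : Type u} [Group Γ] {T : GTree Γ}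

lemma not_isDegenerate {n : ℕ} (hedge : T.HasFreeAbelianEdges n) {x : T.V}
    (hx : ¬ IsFreeAbelianOfRankLE n (T.stab x)) : ¬ T.IsDegenerate x := by
  rintro ⟨y, hxy, h⟩
  exact hx (h ▸ hedge x y hxy)

/-- The complexity is bounded below by the weights of inequivalent vertices whose stabilizers are
too large for edge groups. -/
lemma tsum_weight_le_complexity (φ : GroupVolume.{u}) {n : ℕ} (hT : ¬ T.IsElliptic)
    (hedge : T.HasFreeAbelianEdges n) {ι : Type u} (x : ι → T.V)
    (hx : ∀ i j, x j ∈ MulAction.orbit Γ (x i) → i = j)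
    (hab : ∀ i, ¬ IsFreeAbelianOfRankLE n (T.stab (x i))) :
    ∑' i, (φ.weight (T.stab (x i)) : ℝ≥0∞) ≤ T.complexity φ := by
  rw [complexity, if_neg hT]
  refine le_add_left ?_
  have hinj : Function.Injective fun i =>
      (T.toQuot (x i) : MulAction.orbitRel.Quotient Γ T.V) := fun i j h =>
    (hx j i (Quotient.exact h)).symm
  refine le_trans (ENNReal.tsum_le_tsum fun i => ?_)
    (ENNReal.tsum_comp_le_tsum_of_injective hinj _)
  obtain ⟨g, hg⟩ : ∃ g : Γ, g • x i = Quotient.out (T.toQuot (x i)) :=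
    Quotient.exact (Quotient.out_eq (T.toQuot (x i)))
  have e := T.stabEquivSmul g (x i)
  rw [hg] at e
  have h1 : ¬ T.IsDegenerate (Quotient.out (T.toQuot (x i))) :=
    not_isDegenerate hedge fun h => hab i (h.of_injective e.toMonoidHom e.injective)
  rw [φ.weight_eq_of_mulEquiv e]
  exact le_add_self.trans (if_neg h1).ge

/-- For a normal subgroup `H`, all stabilizers in `H` of the vertices in a `Γ`-orbit are isomorphic:
they are conjugate in `Γ`. -/
def stabRestrictEquiv (T : GTree Γ) (H : Subgroup Γ) [hH : H.Normal] (g : Γ) (v : T.V) :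
    (T.restrict H).stab (g • v : T.V) ≃* H.subgroupOf (T.stab v) where
  toFun h := ⟨⟨g⁻¹ * h.1.1 * g, (T.mem_stab_smul_iff).1 h.2⟩, by
    have := hH.conj_mem _ h.1.2 g⁻¹
    rwa [inv_inv] at this⟩
  invFun h := ⟨⟨g * h.1.1 * g⁻¹, hH.conj_mem _ h.2 g⟩, by
    change (g * h.1.1 * g⁻¹ : Γ) ∈ T.stab (g • v)
    rw [T.mem_stab_smul_iff]
    simp [mul_assoc]⟩
  left_inv h := by ext; simp [mul_assoc]
  right_inv h := by ext; simp [mul_assoc]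
  map_mul' a b := by ext; simp [mul_assoc]

/-- Restricting the action to a normal subgroup `H` of finite index, and reducing the tree, gives a
splitting of `H` whose complexity is at least the index of `H` times the weight of a given vertex
group: the vertices in the orbit of the given vertex become inequivalent, or their stabilizers
become smaller. -/
lemma index_mul_weight_le_maxComplexity [Group.FG Γ] (φ : GroupVolume.{u}) {k n : ℕ}
    (hT : ¬ T.IsElliptic) (hacyl : T.IsAcylindrical k) (hedge : T.HasFreeAbelianEdges n) {v : T.V}
    [Infinite (T.stab v)] (hφ : 0 < φ.weight (T.stab v)) (H : Subgroup Γ) [H.Normal]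
    [H.FiniteIndex] :
    (H.index : ℝ≥0∞) * φ.weight (T.stab v) ≤ maxComplexity φ k n H := by
  let K := T.stab v
  have : (H ⊔ K).FiniteIndex := Subgroup.finiteIndex_of_le le_sup_left
  -- the `H`-orbits in the `Γ`-orbit of `v` correspond to the cosets of `H ⊔ K`
  let x : Γ ⧸ (H ⊔ K) → (T.restrict H).V := fun i => (i.out • v : T.V)
  have hx : ∀ i j, x j ∈ MulAction.orbit H (x i) → i = j := by
    rintro i j ⟨⟨h, hh⟩, hij⟩
    have hij' : h • i.out • v = j.out • v := hij
    rw [← i.out_eq', ← j.out_eq']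
    symm
    refine QuotientGroup.eq.2 ?_
    rw [smul_smul, ← inv_smul_eq_iff, smul_smul] at hij'
    have h1 : j.out⁻¹ * (h * i.out) ∈ K := hij'
    have h2 : j.out⁻¹ * h⁻¹ * j.out ∈ H := by
      simpa using ‹H.Normal›.conj_mem _ (H.inv_mem hh) j.out⁻¹
    have h3 := Subgroup.mul_mem_sup h2 h1
    simpa [mul_assoc] using h3
  have hw : ∀ i, φ.weight ((T.restrict H).stab (x i)) =
      (H.subgroupOf K).index * φ.weight (T.stab v) := fun i => by
    rw [← φ.weight_subgroup _ hφ]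
    exact φ.weight_eq_of_mulEquiv (T.stabRestrictEquiv H i.out v)
  have hab : ∀ i, ¬ IsFreeAbelianOfRankLE n ((T.restrict H).stab (x i)) := by
    intro i h
    have hinf : Infinite (H.subgroupOf K) := by
      by_contra hfin
      rw [not_infinite_iff_finite] at hfin
      have h1 := (H.subgroupOf K).card_mul_index
      rw [Nat.card_eq_zero_of_infinite (α := K)] at h1
      exact mul_ne_zero Nat.card_pos.ne' Subgroup.FiniteIndex.index_ne_zero h1
    have : Infinite ((T.restrict H).stab (x i)) :=
      (T.stabRestrictEquiv H i.out v).toEquiv.infinite_iff.2 hinf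
    have h0 := GroupVolume.weight_eq_zero (φ := φ) h
    rw [hw i] at h0
    have h1 : (0 : ℝ≥0) < (H.subgroupOf K).index := by
      exact_mod_cast Nat.pos_of_ne_zero Subgroup.FiniteIndex.index_ne_zero
    exact absurd h0 (mul_pos h1 hφ).ne'
  obtain ⟨T₁, r, hfin, hF⟩ := (T.restrict H).exists_subtree (Set.finite_range x)
  choose y hy using fun i => hF ⟨i, rfl⟩
  obtain ⟨T₂, hT₂, hell, z, hz, hstab⟩ := exists_isReduced
    (r.isAcylindrical (isAcylindrical_restrict hacyl H))
    (r.hasFreeAbelianEdges (hasFreeAbelianEdges_restrict hedge H)) y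
    (r.not_isElliptic (not_isElliptic_restrict hT H))
    (fun i j h => hx i j (by rw [← hy, ← hy]; exact r.mem_orbit_iff.2 h))
    (fun i => by rw [r.stab_eq, hy]; exact hab i)
  have hstab' : ∀ i, T₂.stab (z i) = (T.restrict H).stab (x i) := fun i => by
    rw [hstab, r.stab_eq, hy]
  have h1 := tsum_weight_le_complexity φ hell hT₂.2.2 z hz (fun i => by rw [hstab']; exact hab i)
  refine le_trans (le_of_eq ?_) (h1.trans (le_iSup₂_of_le T₂ hT₂ le_rfl))
  have hidx : H.index = (H.subgroupOf K).index * (H ⊔ K).index := by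
    have h2 := Subgroup.relIndex_mul_index (le_sup_left : H ≤ H ⊔ K)
    rw [sup_comm, Subgroup.relIndex_sup_right] at h2
    rw [← h2, sup_comm]; rfl
  have := Fintype.ofFinite (Γ ⧸ (H ⊔ K))
  have hz' : ∀ i, φ.weight (T₂.stab (z i)) = (H.subgroupOf K).index * φ.weight (T.stab v) :=
    fun i => by rw [hstab', hw]
  simp_rw [hz']
  rw [tsum_fintype, Finset.sum_const, Finset.card_univ, ← Nat.card_eq_fintype_card,
    ← Subgroup.index, hidx, nsmul_eq_mul]
  push_cast
  ring

end GTree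

end

theorem mainTheorem1 (G : Type u) [Group G] [Group.FG G] (hG : IsOneEnded G)
    (φ : GroupVolume.{u}) (k n : ℕ) (hn : 0 < n)
    (T : GTree G) (hT : ¬ T.IsElliptic)
    (hacyl : T.IsAcylindrical k) (hedge : T.HasFreeAbelianEdges n)
    (v : T.V) (hv : T.stab v ≠ ⊥) (hφ : 0 < φ.weight (T.stab v)) :
    0 < acylVolume φ k n G ∧ (φ.weight (T.stab v) : ℝ≥0∞) ≤ acylVolume φ k n G := by
  have hinf : Infinite (T.stab v) := by
    refine GTree.infinite_stab hG hT hv fun hfin w hw => ?_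
    have : Finite (T.pathStab v w) :=
      Finite.of_injective (Subgroup.inclusion inf_le_left)
        (Subgroup.inclusion_injective inf_le_left)
    rw [Subgroup.eq_bot_iff_forall]
    intro g hg
    exact congrArg Subtype.val ((hedge v w hw).eq_one_of_finite ⟨g, hg⟩)
  have key : (φ.weight (T.stab v) : ℝ≥0∞) ≤ acylVolume φ k n G := by
    have : Nonempty (FiniteIndexNormalSubgroup G) := ⟨.ofSubgroup ⊤⟩
    refine Filter.le_limsup_of_frequently_le' (Filter.Frequently.of_forall fun H => ?_)
    rw [ENNReal.le_div_iff_mul_le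
      (Or.inl (Nat.cast_ne_zero.2 H.isFiniteIndex'.index_ne_zero))
      (Or.inl (ENNReal.natCast_ne_top _)), mul_comm]
    exact GTree.index_mul_weight_le_maxComplexity φ hT hacyl hedge hφ H.toSubgroup
  exact ⟨lt_of_lt_of_le (by exact_mod_cast hφ) key, key⟩
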